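/- Let $R$ be an associative ring with $1$; modules are right $R$-modules. For a module $M$, let $\sigma(M)$ be the class of modules isomorphic to a submodule of a quotient of a direct sum of copies of $M$. A module $E$ is almost $N$-injective if for every submodule $N'\subseteq N$ with inclusion $\iota:N'\to N$ and every homomorphism $f:N'\to E$, either there is $g:N\to E$ with $f=g\iota$, or there are a nonzero idempotent $\pi\in\operatorname{End}_R(N)$ and a homomorphism $h:E\to\pi(N)$ with $hf=\pi\iota$; it is $N$-injective if the first alternative always holds. A module $P$ is $M$-projective if every homomorphism from $P$ to a quotient $M/K$ lifts to a homomorphism $P\to M$. A module $M$ is a $V$-module if every simple module is $M$-injective, and an almost $V$-module if every simple module is almost $N$-injective for every $N\in\sigma(M)$. A module is local if it has a largest proper submodule. The Jacobson radical $J(N)$ is the intersection of all maximal submodules of $N$ (equal to $N$ if there are none), and the injective hull $E_M(S)$ of $S\in\sigma(M)$ is an essential extension $E\in\sigma(M)$ of $S$ that is $X$-injective for every $X\in\sigma(M)$. Let $M$ be an almost $V$-module. Then: 1. For every $N\in\sigma(M)$, the Jacobson radical $J(N)$ is semisimple. 2. For every $N\in\sigma(M)$, the factor module $N/J(N)$ is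 a $V$-module. 3. For every simple module $S\in\sigma(M)$, the injective hull $E_M(S)$ is either a simple module or a local $M$-projective module of length two. -/

import Mathlib

universe u v

namespace AlmostV

section Definitions

variable (R : Type u) [Ring R]

/-- `N ∈ σ(M)`: `N` is subgenerated by `M`, i.e. it embeds in a quotient of a direct sum of
copies of `M`. -/
def IsSubgenerated (M N : Type v) [AddCommGroup M] [Module R M]
    [AddCommGroup N] [Module R N] : Prop :=
  ∃ (I : Type v) (K : Submodule R (I →₀ M)) (i : N →ₗ[R] ((I →₀ M) ⧸ K)), Function.Injective i

/-- `E` is `N`-injective. -/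
def IsRelInjective (N E : Type v) [AddCommGroup N] [Module R N]
    [AddCommGroup E] [Module R E] : Prop :=
  ∀ (N' : Submodule R N) (f : N' →ₗ[R] E), ∃ g : N →ₗ[R] E, g ∘ₗ N'.subtype = f

/-- `P` is `N`-projective. -/
def IsRelProjective (N P : Type v) [AddCommGroup N] [Module R N]
    [AddCommGroup P] [Module R P] : Prop :=
  ∀ (K : Submodule R N) (f : P →ₗ[R] (N ⧸ K)), ∃ g : P →ₗ[R] N, K.mkQ ∘ₗ g = f

/-- `E` is almost `N`-injective. -/
def IsAlmostRelInjective (N E : Type v) [AddCommGroup N] [Module R N]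
    [AddCommGroup E] [Module R E] : Prop :=
  ∀ (N' : Submodule R N) (f : N' →ₗ[R] E),
    (∃ g : N →ₗ[R] E, g ∘ₗ N'.subtype = f) ∨
    ∃ p : Module.End R N, p ≠ 0 ∧ IsIdempotentElem p ∧
      ∃ h : E →ₗ[R] LinearMap.range p, ∀ x : N', (h (f x) : N) = p (x : N)

/-- `M` is a `V`-module: every simple module is `M`-injective. -/
def IsVModule (M : Type v) [AddCommGroup M] [Module R M] : Prop :=
  ∀ (S : Type v) [AddCommGroup S] [Module R S], IsSimpleModule R S → IsRelInjective R M S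

/-- `M` is an almost `V`-module: every simple module is almost `N`-injective for all
`N ∈ σ(M)`. -/
def IsAlmostVModule (M : Type v) [AddCommGroup M] [Module R M] : Prop :=
  ∀ (S : Type v) [AddCommGroup S] [Module R S], IsSimpleModule R S →
    ∀ (N : Type v) [AddCommGroup N] [Module R N], IsSubgenerated R M N →
      IsAlmostRelInjective R N S

/-- A local module: one that has a largest proper submodule. -/
def IsLocalModule (M : Type v) [AddCommGroup M] [Module R M] : Prop :=
  ∃ K : Submodule R M, K ≠ ⊤ ∧ ∀ L : Submodule R M, L ≠ ⊤ → L ≤ K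

/-- `i : S → E` is an injective hull of `S` in the category `σ(M)`: `E` is an injective object
of `σ(M)` and `i` is an essential monomorphism. -/
structure IsInjectiveHullIn (M : Type v) [AddCommGroup M] [Module R M]
    {S E : Type v} [AddCommGroup S] [Module R S] [AddCommGroup E] [Module R E]
    (i : S →ₗ[R] E) : Prop where
  mem : IsSubgenerated R M E
  injective_object : ∀ (X : Type v) [AddCommGroup X] [Module R X],
    IsSubgenerated R M X → IsRelInjective R X E
  mono : Function.Injective i
  essential : ∀ L : Submodule R E, L ⊓ LinearMap.range i = ⊥ → L = ⊥

end Definitions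

end AlmostV

/-! Everything reduces to modules `Q` in `σ(M)` with a least nonzero submodule `S`, the monolith.
Such a `Q` has no idempotent endomorphism except 0 and 1, so almost injectivity of simple modules
becomes true extension from every submodule other than `S` (`exists_extension`). If `Q ≠ S`, almost
injectivity of `S` over a pullback shows that `Q` lifts along epimorphisms in `σ(M)` the maps that
kill `S` (`exists_lift`); hence every epimorphism from `σ(M)` onto `Q` splits (`exists_section`),
and `S` is a maximal submodule (`eq_top_or_isCoatom`), so `Q` has length two.

For the radical, enlarge a submodule to one maximal among those missing a given element `x`: the
quotient has a monolith, so it is simple or a direct summand. The hull of a simple module has that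
module as its monolith. -/

namespace AlmostV

/-! ### The category `σ(M)` and its closure properties. -/

section Subgenerated

variable {A : Type u} [Ring A] {M N X : Type v} [AddCommGroup M] [Module A M]
  [AddCommGroup N] [Module A N] [AddCommGroup X] [Module A X]

/-- `N` lies in `σ(M)` iff the annihilator of every element of `N` contains the annihilator of a
finite subset of `M`. -/
theorem isSubgenerated_iff :
    IsSubgenerated A M N ↔
      ∀ x : N, ∃ F : Finset M, ∀ r : A, (∀ m ∈ F, r • m = 0) → r • x = 0 := by
  classical
  constructor
  · rintro ⟨I, K, i, hi⟩ x
    obtain ⟨w, hw⟩ := K.mkQ_surjective (i x)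
    refine ⟨w.support.image w, fun r hr => hi ?_⟩
    have : r • w = 0 := by
      ext j
      by_cases hj : j ∈ w.support
      · simpa using hr _ (Finset.mem_image_of_mem _ hj)
      · simp [Finsupp.notMem_support_iff.1 hj]
    rw [map_smul, ← hw, ← map_smul, this, map_zero, map_zero]
  · intro h
    choose F hF using h
    -- The annihilator of `w x` is that of `F x`. Distinct `x` occupy disjoint coordinates, so a
    -- linear relation among the `w x` holds term by term; this gives `ker φ ≤ ker ψ`.
    let w : N → (N × M →₀ M) := fun x => ∑ m ∈ F x, Finsupp.single (x, m) m
    have hw : ∀ x y m, w x (y, m) = if x = y ∧ m ∈ F x then m else 0 := by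
      intro x y m
      simp only [w, Finsupp.finsetSum_apply, Finsupp.single_apply, Prod.mk.injEq]
      by_cases hxy : x = y
      · simp [hxy]
      · simp [hxy]
    let φ : (N →₀ A) →ₗ[A] (N × M →₀ M) := Finsupp.linearCombination A w
    let ψ : (N →₀ A) →ₗ[A] N := Finsupp.linearCombination A id
    have hψ : Function.Surjective ψ := fun x => ⟨Finsupp.single x 1, by simp [ψ]⟩
    have hle : LinearMap.ker φ ≤ LinearMap.ker ψ := by
      intro a ha
      rw [LinearMap.mem_ker] at ha ⊢
      simp only [ψ, Finsupp.linearCombination_apply, Finsupp.sum, id]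
      refine Finset.sum_eq_zero fun x hx => hF x _ fun m hm => ?_
      have := DFunLike.congr_fun ha (x, m)
      simp only [φ, Finsupp.linearCombination_apply, Finsupp.sum, Finsupp.finsetSum_apply,
        Finsupp.smul_apply, hw, Finsupp.coe_zero, Pi.zero_apply] at this
      rw [Finset.sum_eq_single x] at this
      · simpa [hm] using this
      · intro y _ hy
        simp [hy]
      · exact fun h => absurd hx h
    let K := (LinearMap.ker ψ).map φ
    let j : ((N →₀ A) ⧸ LinearMap.ker ψ) →ₗ[A] ((N × M →₀ M) ⧸ K) :=
      (LinearMap.ker ψ).mapQ K φ (Submodule.le_comap_map _ _)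
    refine ⟨N × M, K, j ∘ₗ (ψ.quotKerEquivOfSurjective hψ).symm.toLinearMap, ?_⟩
    rw [LinearMap.coe_comp]
    refine Function.Injective.comp ?_ (LinearEquiv.injective _)
    rw [← LinearMap.ker_eq_bot, LinearMap.ker_eq_bot']
    intro q hq
    obtain ⟨a, rfl⟩ := Submodule.mkQ_surjective _ q
    simp only [j, Submodule.mkQ_apply, Submodule.mapQ_apply, Submodule.Quotient.mk_eq_zero] at hq ⊢
    obtain ⟨b, hb, hab⟩ := hq
    have : a - b ∈ LinearMap.ker ψ := hle (by simp [hab])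
    simpa using Submodule.add_mem _ this hb

theorem IsSubgenerated.of_injective (hN : IsSubgenerated A M N) (f : X →ₗ[A] N)
    (hf : Function.Injective f) : IsSubgenerated A M X := by
  obtain ⟨I, K, i, hi⟩ := hN
  exact ⟨I, K, i ∘ₗ f, hi.comp hf⟩

theorem IsSubgenerated.of_surjective (hN : IsSubgenerated A M N) (f : N →ₗ[A] X)
    (hf : Function.Surjective f) : IsSubgenerated A M X := by
  rw [isSubgenerated_iff] at hN ⊢
  intro x
  obtain ⟨y, rfl⟩ := hf x
  obtain ⟨F, hF⟩ := hN y
  exact ⟨F, fun r hr => by rw [← map_smul, hF r hr, map_zero]⟩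

theorem IsSubgenerated.submodule (hN : IsSubgenerated A M N) (L : Submodule A N) :
    IsSubgenerated A M L :=
  hN.of_injective L.subtype L.injective_subtype

theorem IsSubgenerated.quotient (hN : IsSubgenerated A M N) (L : Submodule A N) :
    IsSubgenerated A M (N ⧸ L) :=
  hN.of_surjective L.mkQ L.mkQ_surjective

theorem IsSubgenerated.prod (hN : IsSubgenerated A M N) (hX : IsSubgenerated A M X) :
    IsSubgenerated A M (N × X) := by
  classical
  rw [isSubgenerated_iff] at hN hX ⊢
  rintro ⟨x, y⟩
  obtain ⟨F, hF⟩ := hN x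
  obtain ⟨G, hG⟩ := hX y
  refine ⟨F ∪ G, fun r hr => Prod.ext ?_ ?_⟩
  · exact hF r fun m hm => hr m (Finset.mem_union_left _ hm)
  · exact hG r fun m hm => hr m (Finset.mem_union_right _ hm)

variable (A M) in
theorem IsSubgenerated.refl : IsSubgenerated A M M :=
  isSubgenerated_iff.2 fun x => ⟨{x}, fun r hr => hr x (by simp)⟩

end Subgenerated

/-! ### Relative injectives within the given universe. -/

section Injective

variable {A : Type u} [Ring A] {M : Type v} [AddCommGroup M] [Module A M]

theorem IsSubgenerated.isTorsionBySet {N : Type v} [AddCommGroup N] [Module A N]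
    (hN : IsSubgenerated A M N) :
    Module.IsTorsionBySet A N (Module.annihilator A M : Set A) := by
  rw [isSubgenerated_iff] at hN
  rintro x ⟨r, hr⟩
  obtain ⟨F, hF⟩ := hN x
  exact hF r fun m _ => Module.mem_annihilator.1 hr m

variable (A M) in
theorem small_quotient_annihilator : Small.{v} (A ⧸ Module.annihilator A M) := by
  let f : A ⧸ Module.annihilator A M → (M → M) :=
    Quotient.lift (fun (r : A) (m : M) => r • m) fun a b hab => by
      funext m
      have h := (Submodule.quotientRel_def _).1 hab
      have := Module.mem_annihilator.1 h m
      rwa [sub_smul, sub_eq_zero] at this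
  refine small_of_injective (f := f) ?_
  intro a b hab
  induction a using Quotient.inductionOn with | _ a
  induction b using Quotient.inductionOn with | _ b
  refine Quotient.sound ((Submodule.quotientRel_def _).2 (Module.mem_annihilator.2 fun m => ?_))
  rw [sub_smul, sub_eq_zero]
  exact congrFun hab m

/-- Every module in `σ(M)` embeds, without enlarging the universe, in a module that is injective
relative to all modules in `σ(M)`. -/
theorem IsSubgenerated.exists_embedding_relInjective {N : Type v} [AddCommGroup N] [Module A N]
    (hN : IsSubgenerated A M N) :
    ∃ (I : Type v) (_ : AddCommGroup I) (_ : Module A I) (i : N →ₗ[A] I), Function.Injective i ∧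
      ∀ (X : Type v) [AddCommGroup X] [Module A X], IsSubgenerated A M X →
        IsRelInjective A X I := by
  -- Modules in `σ(M)` are modules over `A ⧸ a`, which acts faithfully on `M` and so is `v`-small
  -- even when `A` is not.
  let a := Module.annihilator A M
  have : Small.{v} (A ⧸ a) := small_quotient_annihilator A M
  let := hN.isTorsionBySet.module
  have : IsScalarTower A (A ⧸ a) N := hN.isTorsionBySet.isScalarTower
  let P := (CategoryTheory.EnoughInjectives.presentation (ModuleCat.of (A ⧸ a) N)).some
  have hinj : Module.Injective (A ⧸ a) P.J :=
    (Module.injective_iff_injective_object _ _).2 P.injective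
  have hmono : Function.Injective P.f.hom := (ModuleCat.mono_iff_injective _).1 P.mono
  let : Module A P.J := Module.compHom P.J (Ideal.Quotient.mk a)
  have : IsScalarTower A (A ⧸ a) P.J := ⟨fun r s x => by
    obtain ⟨s, rfl⟩ := Ideal.Quotient.mk_surjective s
    exact mul_smul (Ideal.Quotient.mk a r) (Ideal.Quotient.mk a s) x⟩
  refine ⟨P.J, inferInstance, inferInstance, P.f.hom.restrictScalars A, hmono, ?_⟩
  intro X _ _ hX L f
  have hL := hX.submodule L
  let := hX.isTorsionBySet.module
  let := hL.isTorsionBySet.module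
  have : IsScalarTower A (A ⧸ a) X := hX.isTorsionBySet.isScalarTower
  have : IsScalarTower A (A ⧸ a) L := hL.isTorsionBySet.isScalarTower
  let f' : L →ₗ[A ⧸ a] P.J :=
    { toFun := f
      map_add' := f.map_add
      map_smul' := fun r x => by
        obtain ⟨r, rfl⟩ := Ideal.Quotient.mk_surjective r
        exact f.map_smul r x }
  let s : L →ₗ[A ⧸ a] X :=
    { toFun := L.subtype
      map_add' := L.subtype.map_add
      map_smul' := fun r x => by
        obtain ⟨r, rfl⟩ := Ideal.Quotient.mk_surjective r
        exact L.subtype.map_smul r x }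
  obtain ⟨g, hg⟩ := hinj.out s L.injective_subtype f'
  exact ⟨g.restrictScalars A, LinearMap.ext hg⟩

end Injective

/-! ### Modules with a least nonzero submodule. -/

section Monolith

variable {A : Type u} [Ring A] {Q X : Type v} [AddCommGroup Q] [Module A Q]
  [AddCommGroup X] [Module A X]

/-- `S` is the least nonzero submodule of `Q`. -/
structure IsMonolith (S : Submodule A Q) : Prop where
  ne_bot : S ≠ ⊥
  le_of_ne_bot : ∀ L : Submodule A Q, L ≠ ⊥ → S ≤ L

variable {S : Submodule A Q}

theorem IsMonolith.isAtom (hS : IsMonolith S) : IsAtom S :=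
  ⟨hS.ne_bot, fun L hL => by_contra fun h => hL.not_ge (hS.le_of_ne_bot L h)⟩

theorem IsMonolith.isSimpleModule (hS : IsMonolith S) : IsSimpleModule A S :=
  isSimpleModule_iff_isAtom.2 hS.isAtom

theorem IsMonolith.eq_bot_of_disjoint (hS : IsMonolith S) {L : Submodule A Q}
    (h : ∀ x ∈ L, x ∈ S → x = 0) : L = ⊥ := by
  by_contra hL
  exact hS.ne_bot ((Submodule.eq_bot_iff _).2 fun x hx => h x (hS.le_of_ne_bot L hL hx) hx)

theorem IsMonolith.injective_or_le_ker (hS : IsMonolith S) (f : Q →ₗ[A] X) :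
    Function.Injective f ∨ S ≤ LinearMap.ker f := by
  by_cases h : LinearMap.ker f = ⊥
  · exact Or.inl (LinearMap.ker_eq_bot.1 h)
  · exact Or.inr (hS.le_of_ne_bot _ h)

/-- The kernel and range of `p` meet trivially, so they cannot both contain `S`. -/
theorem IsMonolith.eq_one_of_isIdempotentElem (hS : IsMonolith S) {p : Module.End A Q}
    (hp : IsIdempotentElem p) (h0 : p ≠ 0) : p = 1 := by
  have hpp : ∀ x, p (p x) = p x := fun x => LinearMap.congr_fun hp x
  rcases hS.injective_or_le_ker p with h | h
  · ext x
    exact h (hpp x)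
  · refine absurd (LinearMap.range_eq_bot.1 (hS.eq_bot_of_disjoint ?_)) h0
    rintro _ ⟨x, rfl⟩ hx
    rw [← hpp]
    exact h hx

theorem IsMonolith.eq_top_of_retraction (hS : IsMonolith S) (g : Q →ₗ[A] S)
    (hg : ∀ s : S, g s = s) : S = ⊤ := by
  have hk : LinearMap.ker g = ⊥ := hS.eq_bot_of_disjoint fun x hx hxS => by
    have := hg ⟨x, hxS⟩
    rw [LinearMap.mem_ker.1 hx] at this
    exact (congrArg Subtype.val this).symm
  refine eq_top_iff.2 fun x _ => ?_
  have : x = (g x : Q) := LinearMap.ker_eq_bot.1 hk (hg (g x)).symm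
  rw [this]
  exact (g x).2

/-- A homomorphism into the monolith of a nonsimple module kills the monolith. -/
theorem IsMonolith.le_ker_of_range_le (hS : IsMonolith S) (hne : S ≠ ⊤) (n : Q →ₗ[A] Q)
    (hn : ∀ x, n x ∈ S) : S ≤ LinearMap.ker n := by
  refine (hS.injective_or_le_ker n).resolve_left fun hinj => hne ?_
  obtain ⟨x, hxS, hx⟩ := (Submodule.ne_bot_iff _).1 hS.ne_bot
  have hmap : S.map n = S := by
    refine (hS.isAtom.le_iff.1 ?_).resolve_left ?_
    · rintro _ ⟨y, -, rfl⟩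
      exact hn y
    · intro h
      have : n x ∈ S.map n := Submodule.mem_map_of_mem hxS
      rw [h, Submodule.mem_bot] at this
      exact hx (hinj (by simpa using this))
  refine eq_top_iff.2 fun y _ => ?_
  obtain ⟨z, hz, hzy⟩ := hmap.ge (hn y)
  exact hinj hzy ▸ hz

end Monolith

/-! ### Extending maps to simple modules. -/

section Extension

variable {A : Type u} [Ring A] {M E : Type v} [AddCommGroup M] [Module A M]
  [AddCommGroup E] [Module A E] {S : Submodule A E}

/-- Over an almost `V`-module, homomorphisms to simple modules extend from every submodule of a
module with monolith `S`, apart from `S` itself. -/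
theorem IsMonolith.exists_extension (hM : IsAlmostVModule A M) (hE : IsSubgenerated A M E)
    (hS : IsMonolith S) {L : Submodule A E} (hL : L ≠ S) {T : Type v} [AddCommGroup T]
    [Module A T] (hT : IsSimpleModule A T) (f : L →ₗ[A] T) :
    ∃ g : E →ₗ[A] T, ∀ x : L, g x = f x := by
  rcases hM T hT E hE L f with ⟨g, hg⟩ | ⟨p, hp0, hp, h, hh⟩
  · exact ⟨g, LinearMap.congr_fun hg⟩
  · have hp1 := hS.eq_one_of_isIdempotentElem hp hp0
    subst hp1
    -- With `p = 1`, `L` embeds in the simple module `T`, so `L` is zero or equals `S`.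
    have hinj : Function.Injective f := fun x y hxy =>
      Subtype.ext ((hh x).symm.trans ((congrArg (fun t => (h t : E)) hxy).trans (hh y)))
    by_cases hbot : L = ⊥
    · subst hbot
      refine ⟨0, fun x => ?_⟩
      rw [Subsingleton.elim x 0]
      simp
    · refine absurd (le_antisymm (fun x hx => ?_) (hS.le_of_ne_bot L hbot)) hL
      obtain ⟨s, hsS, hs⟩ := (Submodule.ne_bot_iff _).1 hS.ne_bot
      have hsL := hS.le_of_ne_bot L hbot hsS
      have hfs : f ⟨s, hsL⟩ ≠ 0 := fun h0 =>
        hs (congrArg Subtype.val (hinj (h0.trans (map_zero f).symm)))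
      obtain ⟨r, hr⟩ := IsSimpleModule.toSpanSingleton_surjective A hfs (f ⟨x, hx⟩)
      have : r • (⟨s, hsL⟩ : L) = ⟨x, hx⟩ := hinj (by rw [map_smul]; exact hr)
      have hxs : x = r • s := (congrArg Subtype.val this).symm
      rw [hxs]
      exact S.smul_mem r hsS

/-- For `x ∈ L` outside `S`, the cyclic module `P` on `x` strictly contains `S`, hence has a maximal
submodule above `S`; the simple quotient map extends from `P` to `E`. -/
theorem IsMonolith.exists_hom_simple (hM : IsAlmostVModule A M) (hE : IsSubgenerated A M E)
    (hS : IsMonolith S) {L : Submodule A E} (hL : ¬ L ≤ S) :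
    ∃ (U : Type v) (_ : AddCommGroup U) (_ : Module A U) (g : E →ₗ[A] U),
      IsSimpleModule A U ∧ S ≤ LinearMap.ker g ∧ ∃ x ∈ L, g x ≠ 0 := by
  obtain ⟨x, hxL, hxS⟩ := SetLike.not_le_iff_exists.1 hL
  let P := Submodule.span A {x}
  have hxP : x ∈ P := Submodule.mem_span_singleton_self x
  have hPS : P ≠ S := fun h => hxS (h ▸ hxP)
  have hSP : S ≤ P := hS.le_of_ne_bot P fun h => hxS (by
    have : x = 0 := by simpa [h] using hxP
    simp [this])
  have : Module.Finite A P := Module.Finite.iff_fg.2 (Submodule.fg_span_singleton x)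
  have htop : S.comap P.subtype ≠ ⊤ := fun h =>
    hxS (show (⟨x, hxP⟩ : P) ∈ S.comap P.subtype from h ▸ trivial)
  obtain ⟨K, hK, hSK⟩ := (eq_top_or_exists_le_coatom (S.comap P.subtype)).resolve_left htop
  have hsimple : IsSimpleModule A (P ⧸ K) := isSimpleModule_iff_isCoatom.2 hK
  obtain ⟨g, hg⟩ := hS.exists_extension hM hE hPS hsimple K.mkQ
  refine ⟨P ⧸ K, inferInstance, inferInstance, g, hsimple, fun s hs => ?_, x, hxL, fun h0 => ?_⟩
  · rw [LinearMap.mem_ker, hg ⟨s, hSP hs⟩, Submodule.mkQ_apply, Submodule.Quotient.mk_eq_zero]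
    exact hSK hs
  · rw [hg ⟨x, hxP⟩, Submodule.mkQ_apply, Submodule.Quotient.mk_eq_zero] at h0
    refine hK.1 (eq_top_iff.2 ?_)
    rintro ⟨y, hy⟩ -
    obtain ⟨r, rfl⟩ := Submodule.mem_span_singleton.1 hy
    exact K.smul_mem r h0

/-- If `χ ≠ 0`, then `D = χ⁻¹(S)` differs from `S`, so `χ` on `D` extends to `m : E → S`. The image
`χ (ker m)` meets `S` trivially, so `ker m ≤ ker χ`; as `m` takes all its values on `D`, so does
`χ`. -/
theorem IsMonolith.range_le_of_le_ker (hM : IsAlmostVModule A M) (hE : IsSubgenerated A M E)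
    (hS : IsMonolith S) (χ : E →ₗ[A] E) (hχ : S ≤ LinearMap.ker χ) : LinearMap.range χ ≤ S := by
  by_cases h0 : χ = 0
  · simp [h0]
  have hrange : S ≤ LinearMap.range χ := hS.le_of_ne_bot _ (mt LinearMap.range_eq_bot.1 h0)
  let D := S.comap χ
  have hDS : D ≠ S := by
    intro h
    obtain ⟨s, hs, hs0⟩ := (Submodule.ne_bot_iff _).1 hS.ne_bot
    obtain ⟨d, rfl⟩ := hrange hs
    have : d ∈ S := h ▸ (show d ∈ D from hs)
    exact hs0 (hχ this)
  let f : D →ₗ[A] S := (χ ∘ₗ D.subtype).codRestrict S fun d => d.2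
  obtain ⟨m, hm⟩ := hS.exists_extension hM hE hDS hS.isSimpleModule f
  have hker : ∀ k, m k = 0 → χ k = 0 := by
    have : (LinearMap.ker m).map χ = ⊥ := hS.eq_bot_of_disjoint (by
      rintro _ ⟨k, hk, rfl⟩ hkS
      have h1 : (m k : E) = χ k := congrArg Subtype.val (hm ⟨k, hkS⟩)
      rw [← h1, LinearMap.mem_ker.1 hk]
      rfl)
    intro k hk
    have h2 : χ k ∈ (LinearMap.ker m).map χ := Submodule.mem_map_of_mem hk
    simpa [this] using h2
  rintro _ ⟨e, rfl⟩
  obtain ⟨d, hd⟩ := hrange (m e).2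
  have hdD : d ∈ D := by
    change χ d ∈ S
    rw [hd]
    exact (m e).2
  have h1 : m d = m e := Subtype.ext ((congrArg Subtype.val (hm ⟨d, hdD⟩)).trans hd)
  have h2 : χ (e - d) = 0 := hker _ (by rw [map_sub, h1, sub_self])
  rw [map_sub, sub_eq_zero] at h2
  rw [h2]
  exact hdD

end Extension

/-! ### Projectivity from almost injectivity. -/

section Lifting

variable {A : Type u} [Ring A] {M E X T : Type v} [AddCommGroup M] [Module A M]
  [AddCommGroup E] [Module A E] [AddCommGroup X] [Module A X] [AddCommGroup T] [Module A T]
  {S : Submodule A E}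

/-- Over an almost `V`-module, a nonsimple module with monolith `S` is projective relative to
all epimorphisms in `σ(M)`, for homomorphisms that kill `S`. -/
theorem IsMonolith.exists_lift (hM : IsAlmostVModule A M) (hE : IsSubgenerated A M E)
    (hX : IsSubgenerated A M X) (hS : IsMonolith S) (hne : S ≠ ⊤) (β : E →ₗ[A] T)
    (hβ : S ≤ LinearMap.ker β) (α : X →ₗ[A] T) (hα : Function.Surjective α) :
    ∃ χ : E →ₗ[A] X, α ∘ₗ χ = β := by
  -- `P` is the pullback of `β` and `α`. Almost injectivity of `S` is applied to the projection `S ×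
  -- ker α → S`; a section of `P → E` then gives the lift.
  let P : Submodule A (E × X) :=
    LinearMap.ker (β ∘ₗ LinearMap.fst A E X - α ∘ₗ LinearMap.snd A E X)
  have mem_P : ∀ z : E × X, z ∈ P ↔ β z.1 = α z.2 := fun z => by
    simp [P, sub_eq_zero]
  let N' : Submodule A P := (S.prod (LinearMap.ker α)).comap P.subtype
  have mem_N' : ∀ z : P, z ∈ N' ↔ z.1.1 ∈ S ∧ α z.1.2 = 0 := fun z => by
    simp [N', Submodule.mem_prod]
  let f : N' →ₗ[A] S :=
    (LinearMap.fst A E X ∘ₗ P.subtype ∘ₗ N'.subtype).codRestrict S fun z => ((mem_N' z.1).1 z.2).1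
  let fstP : P →ₗ[A] E := LinearMap.fst A E X ∘ₗ P.subtype
  have hfst : Function.Surjective fstP := fun e => by
    obtain ⟨x, hx⟩ := hα (β e)
    exact ⟨⟨(e, x), (mem_P _).2 hx.symm⟩, rfl⟩
  have ker_fst : ∀ z : P, fstP z = 0 → z ∈ N' := fun z hz => by
    have h1 : z.1.1 = 0 := hz
    refine (mem_N' z).2 ⟨by rw [h1]; exact S.zero_mem, ?_⟩
    rw [← (mem_P z.1).1 z.2, h1, map_zero]
  have f_eq_zero : ∀ z : N', fstP z = 0 → f z = 0 := fun z hz => Subtype.ext hz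
  -- a homomorphism on `P` that kills the kernel of `fstP` factors through `fstP`
  have factor : ∀ {Y : Type v} [AddCommGroup Y] [Module A Y] (g : P →ₗ[A] Y),
      (∀ z, fstP z = 0 → g z = 0) → ∃ g' : E →ₗ[A] Y, ∀ z, g' (fstP z) = g z := by
    intro Y _ _ g hg
    let e := fstP.quotKerEquivOfSurjective hfst
    refine ⟨(LinearMap.ker fstP).liftQ g (fun z hz => hg z hz) ∘ₗ e.symm.toLinearMap, fun z => ?_⟩
    have : e.symm (fstP z) = Submodule.Quotient.mk z := by
      rw [LinearEquiv.symm_apply_eq]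
      rfl
    rw [LinearMap.comp_apply, LinearEquiv.coe_coe, this]
    rfl
  have inS : ∀ s : S, ((s : E), (0 : X)) ∈ P := fun s => (mem_P _).2 (by simpa using hβ s.2)
  have inN' : ∀ s : S, (⟨_, inS s⟩ : P) ∈ N' := fun s => (mem_N' _).2 ⟨s.2, map_zero α⟩
  rcases hM S hS.isSimpleModule P ((hE.prod hX).submodule P) N' f with
    ⟨g, hg⟩ | ⟨π, hπ0, hπ, h, hh⟩
  -- An extension would induce a retraction of `E` onto `S`, forcing `S = ⊤`.
  · have hg : ∀ z : N', g z = f z := LinearMap.congr_fun hg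
    obtain ⟨g', hg'⟩ := factor g fun z hz => by
      rw [hg ⟨z, ker_fst z hz⟩]
      exact f_eq_zero _ hz
    refine absurd (hS.eq_top_of_retraction g' fun s => ?_) hne
    refine (hg' ⟨_, inS s⟩).trans ((hg ⟨_, inN' s⟩).trans (Subtype.ext rfl))
  -- In this case `π` turns out to have the same kernel as `fstP`, so it splits `fstP`.
  · have hππ : ∀ z, π (π z) = π z := fun z => LinearMap.congr_fun hπ z
    have hπker : ∀ z, fstP z = 0 → π z = 0 := fun z hz => by
      rw [← hh ⟨z, ker_fst z hz⟩, f_eq_zero ⟨z, ker_fst z hz⟩ hz, map_zero]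
      rfl
    have essential : ∀ W : Submodule A P, (∀ w ∈ W, w ∈ N' → w = 0) → W = ⊥ := by
      intro W hW
      have : W.map fstP = ⊥ := hS.eq_bot_of_disjoint (by
        rintro _ ⟨w, hw, rfl⟩ hwS
        have : w ∈ N' := (mem_N' w).2 ⟨hwS, by rw [← (mem_P w.1).1 w.2]; exact hβ hwS⟩
        rw [hW w hw this, map_zero])
      refine (Submodule.eq_bot_iff _).2 fun w hw => hW w hw (ker_fst w ?_)
      have h1 : fstP w ∈ W.map fstP := Submodule.mem_map_of_mem hw
      simpa [this] using h1
    have hh0 : h ≠ 0 := by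
      rintro rfl
      refine hπ0 (LinearMap.range_eq_bot.1 (essential _ ?_))
      rintro _ ⟨z, rfl⟩ hz
      rw [← hππ, ← hh ⟨_, hz⟩]
      rfl
    have := hS.isSimpleModule
    have hhinj : ∀ s, h s = 0 → s = 0 := by
      have hker : LinearMap.ker h = ⊥ :=
        (eq_bot_or_eq_top _).resolve_right (mt LinearMap.ker_eq_top.1 hh0)
      intro s hs
      simpa [hker] using LinearMap.mem_ker.2 hs
    have ker_π : ∀ z, π z = 0 → fstP z = 0 := by
      have : (LinearMap.ker π).map fstP = ⊥ := hS.eq_bot_of_disjoint (by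
        rintro _ ⟨w, hw, rfl⟩ hwS
        have hwN : w ∈ N' := (mem_N' w).2 ⟨hwS, by rw [← (mem_P w.1).1 w.2]; exact hβ hwS⟩
        have h1 := hh ⟨w, hwN⟩
        rw [LinearMap.mem_ker.1 hw] at h1
        have h2 : f ⟨w, hwN⟩ = 0 := hhinj _ (Subtype.ext h1)
        exact congrArg Subtype.val h2)
      intro z hz
      have h1 : fstP z ∈ (LinearMap.ker π).map fstP := Submodule.mem_map_of_mem hz
      simpa [this] using h1
    obtain ⟨χ, hχ⟩ := factor (LinearMap.snd A E X ∘ₗ P.subtype ∘ₗ π) fun z hz => by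
      simp [hπker z hz]
    refine ⟨χ, LinearMap.ext fun e => ?_⟩
    obtain ⟨z, rfl⟩ := hfst e
    have h1 : fstP (π z) = fstP z := by
      rw [← sub_eq_zero, ← map_sub]
      exact ker_π _ (by rw [map_sub, hππ, sub_self])
    rw [LinearMap.comp_apply, hχ, ← h1]
    exact ((mem_P (π z).1).1 (π z).2).symm

end Lifting

/-! ### Length two, splitting, and the three assertions. -/

section Length

variable {A : Type u} [Ring A] {M Q N : Type v} [AddCommGroup M] [Module A M]
  [AddCommGroup Q] [Module A Q] [AddCommGroup N] [Module A N] {S : Submodule A Q}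

/-- If the maximal submodule `ker g` exceeds `S`, some `g₂` killing `S` maps it onto a simple `U`,
and `g₂` lifts to `χ : Q → ker g`. An injective `χ` would be a nonsurjective injective endomorphism;
otherwise its range lies in `S`, which `g₂` kills. -/
theorem IsMonolith.eq_top_or_isCoatom_of_surjective_of_injective (hM : IsAlmostVModule A M)
    (hQ : IsSubgenerated A M Q) (hS : IsMonolith S)
    (hsurj : ∀ χ : Q →ₗ[A] Q, Function.Injective χ → Function.Surjective χ) :
    S = ⊤ ∨ IsCoatom S := by
  refine or_iff_not_imp_left.2 fun hne => ?_
  obtain ⟨T, _, _, g, hT, hSg, x, -, hx⟩ :=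
    hS.exists_hom_simple hM hQ (L := ⊤) (by simpa [top_le_iff] using hne)
  have hcoatom : IsCoatom (LinearMap.ker g) :=
    LinearMap.isCoatom_ker_of_surjective
      (LinearMap.surjective_of_ne_zero fun h => hx (by rw [h]; rfl))
  by_cases hle : LinearMap.ker g ≤ S
  · rwa [le_antisymm hSg hle]
  obtain ⟨U, _, _, g₂, hU, hSg₂, y, hy, hgy⟩ := hS.exists_hom_simple hM hQ hle
  let α : LinearMap.ker g →ₗ[A] U := g₂ ∘ₗ (LinearMap.ker g).subtype
  have hα : Function.Surjective α :=
    LinearMap.surjective_of_ne_zero fun h => hgy (LinearMap.congr_fun h ⟨y, hy⟩)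
  obtain ⟨χ, hχ⟩ := hS.exists_lift hM hQ (hQ.submodule _) hne g₂ hSg₂ α hα
  rcases hS.injective_or_le_ker ((LinearMap.ker g).subtype ∘ₗ χ) with h | h
  · refine absurd (eq_top_iff.2 fun z _ => ?_) hcoatom.1
    obtain ⟨w, rfl⟩ := hsurj _ h z
    exact (χ w).2
  · have hmem := hS.range_le_of_le_ker hM hQ _ h (LinearMap.mem_range_self _ y)
    exact absurd ((LinearMap.congr_fun hχ y).symm.trans (hSg₂ hmem)) hgy

/-- A module in `σ(M)` with a monolith embeds in a module in `σ(M)` with the same monolith all of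
whose injective endomorphisms are surjective. -/
theorem IsMonolith.exists_embedding (hQ : IsSubgenerated A M Q) (hS : IsMonolith S) :
    ∃ (E : Type v) (_ : AddCommGroup E) (_ : Module A E) (j : Q →ₗ[A] E),
      IsSubgenerated A M E ∧ Function.Injective j ∧ IsMonolith (S.map j) ∧
      ∀ χ : E →ₗ[A] E, Function.Injective χ → Function.Surjective χ := by
  obtain ⟨I, _, _, i, hi, hI⟩ := hQ.exists_embedding_relInjective
  -- A maximal member of `Z` serves as the hull: the two conditions say that `S` stays the monolith
  -- and that the submodule stays in `σ(M)`.
  let Z : Set (Submodule A I) :=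
    {L | (∀ x ∈ L, x ≠ 0 → S.map i ≤ Submodule.span A {x}) ∧
      ∀ x ∈ L, ∃ F : Finset M, ∀ r : A, (∀ m ∈ F, r • m = 0) → r • x = 0}
  have hrange : LinearMap.range i ∈ Z := by
    constructor
    · rintro _ ⟨x, rfl⟩ hx
      rw [← Set.image_singleton, ← Submodule.map_span]
      refine Submodule.map_mono (hS.le_of_ne_bot _ ?_)
      rw [Ne, Submodule.span_singleton_eq_bot]
      rintro rfl
      exact hx (map_zero i)
    · rintro _ ⟨x, rfl⟩
      obtain ⟨F, hF⟩ := isSubgenerated_iff.1 hQ x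
      exact ⟨F, fun r hr => by rw [← map_smul, hF r hr, map_zero]⟩
  obtain ⟨m, him, hm⟩ := zorn_le_nonempty₀ Z (by
    intro c hcZ hc y hy
    refine ⟨sSup c, ⟨fun x hx => ?_, fun x hx => ?_⟩, fun z hz => le_sSup hz⟩
    all_goals
      obtain ⟨L, hL, hxL⟩ := (Submodule.mem_sSup_of_directed ⟨y, hy⟩ hc.directedOn).1 hx
    · exact (hcZ hL).1 x hxL
    · exact (hcZ hL).2 x hxL) _ hrange
  let j : Q →ₗ[A] m := i.codRestrict m fun x => him (LinearMap.mem_range_self i x)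
  have hj : Function.Injective j := fun x y hxy => hi (congrArg Subtype.val hxy)
  have hm_sub : IsSubgenerated A M m := isSubgenerated_iff.2 fun x => by
    obtain ⟨F, hF⟩ := hm.prop.2 x x.2
    exact ⟨F, fun r hr => Subtype.ext (hF r hr)⟩
  have hS' : IsMonolith (S.map j) := by
    constructor
    · intro h
      have h1 : S ≤ LinearMap.ker j := Submodule.map_le_iff_le_comap.1 h.le
      rw [LinearMap.ker_eq_bot.2 hj] at h1
      exact hS.ne_bot (le_bot_iff.1 h1)
    · rintro L hL _ ⟨s, hs, rfl⟩
      obtain ⟨x, hxL, hx⟩ := (Submodule.ne_bot_iff _).1 hL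
      have hmem := hm.prop.1 x x.2 (fun h => hx (Subtype.ext h)) (Submodule.mem_map_of_mem hs)
      obtain ⟨r, hr⟩ := Submodule.mem_span_singleton.1 hmem
      have : j s = r • x := Subtype.ext hr.symm
      rw [this]
      exact L.smul_mem r hxL
  refine ⟨m, inferInstance, inferInstance, j, hm_sub, hj, hS', fun χ hχ => ?_⟩
  let e := LinearEquiv.ofInjective χ hχ
  -- The inverse of `χ` extends to an injective `g : m → I` whose range contains `m` and lies in
  -- `Z`; maximality makes the range equal `m`, so `χ` is onto.
  obtain ⟨g, hg⟩ := hI m hm_sub (LinearMap.range χ) (m.subtype ∘ₗ e.symm.toLinearMap)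
  have hgχ : ∀ x, g (χ x) = x := fun x => by
    have h1 := LinearMap.congr_fun hg (e x)
    simp only [LinearMap.comp_apply, LinearEquiv.coe_coe, e.symm_apply_apply] at h1
    exact h1
  obtain ⟨s, hs, hs0⟩ := (Submodule.ne_bot_iff _).1 hS'.ne_bot
  obtain ⟨t, ht⟩ := hS'.le_of_ne_bot (LinearMap.range χ) (by
    intro h
    rw [LinearMap.range_eq_bot] at h
    exact hs0 (hχ (by simp [h]))) hs
  have hginj : Function.Injective g := by
    refine (hS'.injective_or_le_ker g).resolve_right fun h => hs0 ?_
    have h1 : g s = 0 := h hs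
    rw [← ht, hgχ] at h1
    rw [← ht, show t = 0 from Subtype.ext h1, map_zero]
  have hχS : S.map j ≤ (S.map j).comap χ := hS'.le_of_ne_bot _ fun h => by
    have h1 : t ∈ (S.map j).comap χ := by
      rw [Submodule.mem_comap, ht]
      exact hs
    rw [h, Submodule.mem_bot] at h1
    rw [h1, map_zero] at ht
    exact hs0 ht.symm
  have hgZ : LinearMap.range g ∈ Z := by
    constructor
    · rintro _ ⟨x, rfl⟩ hx _ ⟨q, hq, rfl⟩
      have hspan := hS'.le_of_ne_bot (Submodule.span A {x}) (by
        rw [Ne, Submodule.span_singleton_eq_bot]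
        rintro rfl
        exact hx (map_zero g))
      obtain ⟨r, hr⟩ := Submodule.mem_span_singleton.1
        (hspan (hχS (Submodule.mem_map_of_mem (f := j) hq)))
      refine Submodule.mem_span_singleton.2 ⟨r, ?_⟩
      rw [← map_smul, hr]
      exact hgχ (j q)
    · rintro _ ⟨x, rfl⟩
      obtain ⟨F, hF⟩ := isSubgenerated_iff.1 hm_sub x
      exact ⟨F, fun r hr => by rw [← map_smul, hF r hr, map_zero]⟩
  have hgm : LinearMap.range g ≤ m := hm.le_of_ge hgZ fun x hx => ⟨χ ⟨x, hx⟩, hgχ ⟨x, hx⟩⟩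
  exact fun x => ⟨⟨g x, hgm (LinearMap.mem_range_self g x)⟩, hginj (hgχ _)⟩

theorem IsMonolith.eq_top_or_isCoatom (hM : IsAlmostVModule A M) (hQ : IsSubgenerated A M Q)
    (hS : IsMonolith S) : S = ⊤ ∨ IsCoatom S := by
  obtain ⟨E, _, _, j, hE, hj, hS', hsurj⟩ := hS.exists_embedding hQ
  have hmap : ∀ L : Submodule A Q, L.map j = ⊤ → L = ⊤ := fun L h => by
    rw [← Submodule.comap_map_eq_of_injective hj L, h, Submodule.comap_top]
  rcases hS'.eq_top_or_isCoatom_of_surjective_of_injective hM hE hsurj with h | h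
  · exact Or.inl (hmap S h)
  · refine or_iff_not_imp_left.2 fun hne => ⟨hne, fun L hL => hmap L (h.2 _ ?_)⟩
    exact Submodule.map_strictMono_of_injective hj hL

/-- Over an almost `V`-module, a nonsimple module with a monolith is a direct summand of each
module in `σ(M)` that maps onto it. -/
theorem IsMonolith.exists_section (hM : IsAlmostVModule A M) (hQ : IsSubgenerated A M Q)
    (hN : IsSubgenerated A M N) (hS : IsMonolith S) (hne : S ≠ ⊤) (q : N →ₗ[A] Q)
    (hq : Function.Surjective q) : ∃ χ : Q →ₗ[A] N, q ∘ₗ χ = LinearMap.id := by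
  obtain ⟨χ, hχ⟩ := hS.exists_lift hM hQ hN hne S.mkQ (by rw [Submodule.ker_mkQ])
    (S.mkQ ∘ₗ q) (S.mkQ_surjective.comp hq)
  -- The lift is a section only modulo `S`; as `n` squares to zero, `1 - n` inverts `q ∘ₗ χ = 1 +
  -- n`.
  let n : Q →ₗ[A] Q := q ∘ₗ χ - LinearMap.id
  have hn : ∀ x, n x ∈ S := fun x => by
    rw [← S.ker_mkQ, LinearMap.mem_ker]
    simpa [n, sub_eq_zero] using LinearMap.congr_fun hχ x
  have hnn : ∀ x, n (n x) = 0 := fun x => hS.le_ker_of_range_le hne n hn (hn x)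
  have hqχ : ∀ x, q (χ x) = x + n x := fun x => by simp [n]
  refine ⟨χ ∘ₗ (LinearMap.id - n), LinearMap.ext fun x => ?_⟩
  simp [hqχ, hnn]

theorem exists_isMonolith_quotient (Z : Submodule A N) {x : N} (hx : x ∉ Z) :
    ∃ C : Submodule A N, Z ≤ C ∧ x ∉ C ∧ IsMonolith (Submodule.span A {C.mkQ x}) := by
  obtain ⟨C, hZC, hC⟩ := zorn_le_nonempty₀ {L : Submodule A N | x ∉ L} (by
    intro c hc hchain y hy
    refine ⟨sSup c, fun h => ?_, fun z hz => le_sSup hz⟩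
    obtain ⟨L, hL, hxL⟩ := (Submodule.mem_sSup_of_directed ⟨y, hy⟩ hchain.directedOn).1 h
    exact hc hL hxL) Z hx
  refine ⟨C, hZC, hC.prop, ?_, fun L hL => ?_⟩
  · rw [Ne, Submodule.span_singleton_eq_bot, Submodule.mkQ_apply, Submodule.Quotient.mk_eq_zero]
    exact hC.prop
  · rw [Submodule.span_singleton_le_iff_mem]
    by_contra h
    have hle : L.comap C.mkQ ≤ C := hC.le_of_ge (y := L.comap C.mkQ) h (by
      intro c hc
      have : C.mkQ c = 0 := by simpa using hc
      rw [Submodule.mem_comap, this]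
      exact L.zero_mem)
    refine hL ((Submodule.eq_bot_iff _).2 fun y hy => ?_)
    obtain ⟨y, rfl⟩ := C.mkQ_surjective y
    simpa using hle hy

/-- Suppose `x` lies in the radical but not in the socle, and let `C` contain the socle and be
maximal missing `x`. If `N ⧸ C` is simple, `C` is a maximal submodule missing `x`; otherwise a
section carries the monolith into the socle, hence into `C`. Both are absurd. -/
theorem isSemisimpleModule_jacobson (hM : IsAlmostVModule A M) (hN : IsSubgenerated A M N) :
    IsSemisimpleModule A (Module.jacobson A N) := by
  let soc : Submodule A N := sSup {L | IsSimpleModule A L}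
  have hsoc : IsSemisimpleModule A soc := by
    have hsup : soc = ⨆ L ∈ {L : Submodule A N | IsSimpleModule A L}, id L := sSup_eq_iSup
    rw [hsup]
    exact isSemisimpleModule_biSup_of_isSemisimpleModule_submodule
      fun L (hL : IsSimpleModule A L) => inferInstanceAs (IsSemisimpleModule A L)
  have hle : Module.jacobson A N ≤ soc := by
    intro x hx
    by_contra hxs
    obtain ⟨C, hsC, hxC, hS⟩ := exists_isMonolith_quotient soc hxs
    by_cases hne : Submodule.span A {C.mkQ x} = ⊤
    · have hC : IsCoatom C := by
        rw [← isSimpleModule_iff_isCoatom]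
        have := hS.isSimpleModule
        rw [hne] at this
        exact IsSimpleModule.congr Submodule.topEquiv.symm
      exact hxC (Submodule.mem_sInf.1 hx C hC)
    · obtain ⟨χ, hχ⟩ := hS.exists_section hM (hN.quotient C) hN hne C.mkQ C.mkQ_surjective
      have hχ' : ∀ y, C.mkQ (χ y) = y := LinearMap.congr_fun hχ
      have hχinj : Function.Injective χ := Function.LeftInverse.injective hχ'
      have := hS.isSimpleModule
      have hsimple : IsSimpleModule A ((Submodule.span A {C.mkQ x}).map χ) :=
        IsSimpleModule.congr (Submodule.equivMapOfInjective χ hχinj _).symm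
      have hmem : χ (C.mkQ x) ∈ C := hsC (le_sSup (a := (Submodule.span A {C.mkQ x}).map χ) hsimple
        (Submodule.mem_map_of_mem (Submodule.mem_span_singleton_self _)))
      have h0 : C.mkQ (χ (C.mkQ x)) = 0 := by simpa using hmem
      rw [hχ'] at h0
      exact hxC (by simpa using h0)
  exact IsSemisimpleModule.of_injective _ (Submodule.inclusion_injective hle)

theorem isVModule_of_jacobson_eq_bot (hM : IsAlmostVModule A M) (hN : IsSubgenerated A M N)
    (hJ : Module.jacobson A N = ⊥) : IsVModule A N := by
  intro T _ _ hT L f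
  by_cases hf : f = 0
  · exact ⟨0, by simp [hf]⟩
  obtain ⟨x, hx⟩ : ∃ x, f x ≠ 0 := by
    by_contra! h
    exact hf (LinearMap.ext h)
  obtain ⟨C, hfC, hxC, hS⟩ := exists_isMonolith_quotient ((LinearMap.ker f).map L.subtype)
    (x := (x : N)) (by
      rintro ⟨y, hy, hyx⟩
      exact hx (Subtype.ext hyx ▸ hy))
  -- If `N ⧸ C` is simple, then `L ⊓ C` is the kernel of `f` and `L` maps onto `N ⧸ C`, so `f`
  -- factors through it. Otherwise `N ⧸ C` embeds in `N`, and a maximal submodule missing the image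
  -- of `x` embeds it in a simple module, a contradiction.
  by_cases hne : Submodule.span A {C.mkQ (x : N)} = ⊤
  · let φ : L →ₗ[A] N ⧸ C := C.mkQ ∘ₗ L.subtype
    have hφ : Function.Surjective φ := by
      rw [← LinearMap.range_eq_top, ← top_le_iff, ← hne, Submodule.span_singleton_le_iff_mem]
      exact ⟨x, rfl⟩
    have hker : LinearMap.ker f = LinearMap.ker φ := by
      have hcoatom : IsCoatom (LinearMap.ker f) :=
        LinearMap.isCoatom_ker_of_surjective (LinearMap.surjective_of_ne_zero hf)
      have hle : LinearMap.ker f ≤ LinearMap.ker φ := fun y hy => by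
        simpa [φ] using hfC (Submodule.mem_map_of_mem hy)
      refine (hcoatom.le_iff.1 hle).resolve_left (fun h => hxC ?_) |>.symm
      have : φ x = 0 := LinearMap.mem_ker.1 (h ▸ Submodule.mem_top)
      simpa [φ] using this
    let e := φ.quotKerEquivOfSurjective hφ
    refine ⟨(LinearMap.ker φ).liftQ f hker.ge ∘ₗ e.symm.toLinearMap ∘ₗ C.mkQ,
      LinearMap.ext fun y => ?_⟩
    have : e.symm (φ y) = Submodule.Quotient.mk y := by
      rw [LinearEquiv.symm_apply_eq]
      rfl
    change (LinearMap.ker φ).liftQ f hker.ge (e.symm (φ y)) = f y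
    rw [this]
    rfl
  · obtain ⟨χ, hχ⟩ := hS.exists_section hM (hN.quotient C) hN hne C.mkQ C.mkQ_surjective
    have hχ' : ∀ y, C.mkQ (χ y) = y := LinearMap.congr_fun hχ
    have hs : χ (C.mkQ x) ∉ Module.jacobson A N := by
      rw [hJ, Submodule.mem_bot]
      intro h
      have h1 := hχ' (C.mkQ x)
      rw [h, map_zero] at h1
      exact hxC (by simpa using h1.symm)
    simp only [Module.jacobson, Submodule.mem_sInf, not_forall] at hs
    obtain ⟨W, hW, hsW⟩ := hs
    have hsimple : IsSimpleModule A (N ⧸ W) := isSimpleModule_iff_isCoatom.2 hW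
    let ψ : (N ⧸ C) →ₗ[A] (N ⧸ W) := W.mkQ ∘ₗ χ
    have hψ : ψ (C.mkQ x) ≠ 0 := by simpa [ψ] using hsW
    have hinj : Function.Injective ψ := (hS.injective_or_le_ker ψ).resolve_right fun h =>
      hψ (h (Submodule.mem_span_singleton_self _))
    refine absurd (eq_top_iff.2 fun y _ => ?_) hne
    obtain ⟨r, hr⟩ := IsSimpleModule.toSpanSingleton_surjective A hψ (ψ y)
    exact Submodule.mem_span_singleton.2 ⟨r, hinj (by rw [map_smul]; exact hr)⟩

theorem IsMonolith.isLocalModule (hS : IsMonolith S) (hc : IsCoatom S) : IsLocalModule A Q := by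
  refine ⟨S, hc.1, fun L hL => ?_⟩
  by_cases h : L = ⊥
  · simp [h]
  · exact ((hc.le_iff.1 (hS.le_of_ne_bot L h)).resolve_left hL).le

theorem IsMonolith.length_eq_two (hS : IsMonolith S) (hc : IsCoatom S) :
    Module.length A Q = 2 := by
  have := hS.isSimpleModule
  have : IsSimpleModule A (Q ⧸ S) := isSimpleModule_iff_isCoatom.2 hc
  rw [Module.length_eq_add_of_exact S.subtype S.mkQ S.injective_subtype S.mkQ_surjective
    (LinearMap.exact_subtype_mkQ S), Module.length_eq_one, Module.length_eq_one]
  norm_num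

theorem IsMonolith.isRelProjective (hM : IsAlmostVModule A M) (hQ : IsSubgenerated A M Q)
    (hN : IsSubgenerated A M N) (hS : IsMonolith S) (hne : S ≠ ⊤) : IsRelProjective A N Q := by
  intro K f
  rcases hS.injective_or_le_ker f with hf | hf
  -- An injective `f` identifies `Q` with a quotient of `X ≤ N`, and that quotient map splits.
  · let X := (LinearMap.range f).comap K.mkQ
    let e := LinearEquiv.ofInjective f hf
    let k : X →ₗ[A] LinearMap.range f := K.mkQ.restrict fun _ hx => hx
    have hk : Function.Surjective k := by
      rintro ⟨y, hy⟩
      obtain ⟨z, rfl⟩ := K.mkQ_surjective y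
      exact ⟨⟨z, hy⟩, rfl⟩
    obtain ⟨χ, hχ⟩ := hS.exists_section hM hQ (hN.submodule X) hne (e.symm.toLinearMap ∘ₗ k)
      (e.symm.surjective.comp hk)
    refine ⟨X.subtype ∘ₗ χ, LinearMap.ext fun y => ?_⟩
    have h1 : e.symm (k (χ y)) = y := LinearMap.congr_fun hχ y
    rw [LinearEquiv.symm_apply_eq] at h1
    exact congrArg Subtype.val h1
  · exact hS.exists_lift hM hQ hN hne f hf K.mkQ K.mkQ_surjective

theorem IsInjectiveHullIn.isMonolith_range {T : Type v} [AddCommGroup T] [Module A T]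
    (hT : IsSimpleModule A T) {i : T →ₗ[A] Q} (hi : IsInjectiveHullIn A M i) :
    IsMonolith (LinearMap.range i) := by
  have hsimple : IsSimpleModule A (LinearMap.range i) :=
    IsSimpleModule.congr (LinearEquiv.ofInjective i hi.mono).symm
  have hatom := isSimpleModule_iff_isAtom.1 hsimple
  refine ⟨hatom.1, fun L hL => ?_⟩
  have := (hatom.le_iff.1 (inf_le_right : L ⊓ LinearMap.range i ≤ _)).resolve_left
    (mt (hi.essential L) hL)
  exact inf_eq_right.1 this

end Length

end AlmostV

/-- Right `R`-modules are modules over `Rᵐᵒᵖ`. -/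
theorem proposition2p1 {R : Type u} [Ring R] (M : Type v) [AddCommGroup M] [Module Rᵐᵒᵖ M]
    (hM : AlmostV.IsAlmostVModule Rᵐᵒᵖ M) :
    (∀ (N : Type v) [AddCommGroup N] [Module Rᵐᵒᵖ N], AlmostV.IsSubgenerated Rᵐᵒᵖ M N →
      IsSemisimpleModule Rᵐᵒᵖ (Module.jacobson Rᵐᵒᵖ N)) ∧
    (∀ (N : Type v) [AddCommGroup N] [Module Rᵐᵒᵖ N], AlmostV.IsSubgenerated Rᵐᵒᵖ M N →
      AlmostV.IsVModule Rᵐᵒᵖ (N ⧸ Module.jacobson Rᵐᵒᵖ N)) ∧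
    (∀ (S : Type v) [AddCommGroup S] [Module Rᵐᵒᵖ S], AlmostV.IsSubgenerated Rᵐᵒᵖ M S →
      IsSimpleModule Rᵐᵒᵖ S →
      ∀ (E : Type v) [AddCommGroup E] [Module Rᵐᵒᵖ E] (i : S →ₗ[Rᵐᵒᵖ] E),
        AlmostV.IsInjectiveHullIn Rᵐᵒᵖ M i →
        IsSimpleModule Rᵐᵒᵖ E ∨
          (AlmostV.IsLocalModule Rᵐᵒᵖ E ∧ AlmostV.IsRelProjective Rᵐᵒᵖ M E ∧
            Module.length Rᵐᵒᵖ E = 2)) := by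
  refine ⟨fun N _ _ hN => AlmostV.isSemisimpleModule_jacobson hM hN, fun N _ _ hN => ?_, ?_⟩
  · exact AlmostV.isVModule_of_jacobson_eq_bot hM (hN.quotient _)
      (Module.jacobson_quotient_jacobson _ _)
  · intro S _ _ _ hS E _ _ i hi
    have hmono := hi.isMonolith_range hS
    rcases hmono.eq_top_or_isCoatom hM hi.mem with htop | hc
    · left
      have := hmono.isSimpleModule
      rw [htop] at this
      exact IsSimpleModule.congr Submodule.topEquiv.symm
    · exact Or.inr ⟨hmono.isLocalModule hc,
        hmono.isRelProjective hM hi.mem (AlmostV.IsSubgenerated.refl _ M) hc.1,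
        hmono.length_eq_two hc⟩
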